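/- Let $E$ be a separable real Banach space. For $n\in\mathbb N$ let $E(n)=E\oplus\bigoplus_{i<n}\mathbb R x_i$, and let $S_n(E)$ be the set of all semi-norms on $E(n)$ which extend the norm of $E$ (the $n$-types over $E$). If $F\supseteq E$ is a Banach space extension (isometric inclusion) and $\bar a\in F^n$, the type of $\bar a$ over $E$ is the semi-norm $b+\sum_i\lambda_i x_i\mapsto\|b+\sum_i\lambda_i a_i\|$, and $\bar a$ is said to realise it. Equip $S_n(E)$ with the metric $d(\xi,\zeta)=\inf\max_{i<n}\|a_i-b_i\|$, where the infimum is over all Banach space extensions $F\supseteq E$ and all realisations $\bar a,\bar b\in F^n$ of $\xi$ and $\zeta$ respectively (for $n=0$ the maximum is $0$). The metric density character of $S_n(E)$ is the least cardinality of a $d$-dense subset. A finite-dimensional $E$ is called polyhedral if its closed unit ball is an intersection of finitely many closed half-spaces. 1. If $E$ is finite-dimensional and polyhedral, then $(S_n(E),d)$ is separable for every $n\ge 0$. 2. Otherwise (that is, if $E$ is infinite-dimensional, or finite-dimensional but not polyhedral), the metric density character of $S_n(E)$ is equal to the continuum $2^{\aleph_0}$ for every $n\geq 1$. -/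

import Mathlib

open scoped ENNReal Cardinal

universe u v w

/-- The real vector space `E(I) = E ⊕ ⨁_{i ∈ I} ℝ xᵢ`: a pair `(b, l)` stands for the formal
expression `b + ∑ i, l i • xᵢ`. -/
abbrev FormalSum (I : Type v) (E : Type u) : Type (max u v) := E × (I →₀ ℝ)

/-- The space of (quantifier-free) types `S_I(E)` in the variables `(xᵢ)_{i ∈ I}` over `E`: the
semi-norms on `E(I)` which extend the norm of `E`. -/
def TypeSpace (I : Type v) (E : Type u) [NormedAddCommGroup E] [NormedSpace ℝ E] :
    Type (max u v) :=
  {p : Seminorm ℝ (FormalSum I E) // ∀ b : E, p (b, 0) = ‖b‖}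

namespace TypeSpace

variable {I : Type v} {E : Type u} [NormedAddCommGroup E] [NormedSpace ℝ E]

/-- The type `tp(a/E)` of a family `a` in an extension `j : E → F` of `E`: the semi-norm
`b + ∑ i, l i • xᵢ ↦ ‖j b + ∑ i, l i • a i‖`. -/
noncomputable def tp {F : Type w} [NormedAddCommGroup F] [NormedSpace ℝ F]
    (j : E →ₗᵢ[ℝ] F) (a : I → F) : TypeSpace I E :=
  ⟨(normSeminorm ℝ F).comp (j.toLinearMap.coprod (Finsupp.linearCombination ℝ a)), by
    intro b; simp⟩

/-- The distance between two types over `E`: the infimum, over all Banach space extensions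
`j : E → F` and all realisations `a` of `ξ` and `b` of `ζ` in `F`, of `sup_i ‖a i - b i‖`. -/
noncomputable def typeDist (ξ ζ : TypeSpace I E) : ℝ≥0∞ :=
  sInf {r : ℝ≥0∞ | ∃ (F : Type (max u v)) (_ : NormedAddCommGroup F) (_ : NormedSpace ℝ F)
    (_ : CompleteSpace F) (j : E →ₗᵢ[ℝ] F) (a b : I → F),
      tp j a = ξ ∧ tp j b = ζ ∧ r = ⨆ i, ‖a i - b i‖ₑ}

/-- Density with respect to the distance between types. -/
def IsMetricallyDense (D : Set (TypeSpace I E)) : Prop :=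
  ∀ ξ : TypeSpace I E, ∀ ε : ℝ≥0∞, 0 < ε → ∃ ζ ∈ D, typeDist ξ ζ < ε

variable (I E)

/-- `S_I(E)` is metrically separable: it has a countable metrically dense subset. -/
def IsMetricallySeparable : Prop :=
  ∃ D : Set (TypeSpace I E), D.Countable ∧ IsMetricallyDense D

/-- The metric density character of `S_I(E)`: the least cardinality of a metrically dense
subset. -/
noncomputable def metricDensityCharacter : Cardinal.{max u v} :=
  sInf {κ : Cardinal.{max u v} | ∃ D : Set (TypeSpace I E), IsMetricallyDense D ∧ #D = κ}

end TypeSpace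

/-- The closed unit ball of `E` is a polyhedron, that is, an intersection of finitely many closed
half-spaces `{x | f x ≤ c}`. -/
def HasPolyhedralUnitBall (E : Type u) [NormedAddCommGroup E] [NormedSpace ℝ E] : Prop :=
  ∃ T : Set (StrongDual ℝ E × ℝ), T.Finite ∧
    Metric.closedBall (0 : E) 1 = {x : E | ∀ h ∈ T, h.1 x ≤ h.2}

/-! Everything is read off the functionals of norm at most one on `E`.

If `E` is not finite-dimensional polyhedral, infinitely many such functionals norm smooth points: by
Mazur's theorem smooth points are dense, so a finite family would compute the whole norm. A smooth
point weak-* exposes its norming functional, and an infinite Hausdorff space has an infinite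
discrete subspace, so there are `φ n` and `b n` with `φ n (b n) = ‖b n‖` and `φ m (b n) ≤ ‖b n‖ - 1`
for `m ≠ n`. For `S ⊆ ℕ`, adjoin `(0, 1)` to the graph of `b ↦ (φ m b)_{m ∈ S}` in `E × ℓ^∞(S)`: the
norm of `b n + x` jumps by 1 according to whether `n ∈ S`. This gives `2^ℕ` uniformly separated
types; separability of `E` bounds their number by the continuum.

If the norm is a maximum of finitely many `φ k`, a type over finitely many variables is encoded by a
compact convex set of functionals over the simplex of convex combinations of the `φ k`. Two types
are close once their fibres over each simplex point are close. Fibres vary in a controlled way under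
multiplicative comparison of coefficients, for which the simplex is separable, so countably many
finite nets describe all types up to any error. -/

/-- Gateaux smoothness of the norm at `u`. -/
def IsSmoothPoint {E : Type*} [NormedAddCommGroup E] [NormedSpace ℝ E] (u : E) : Prop :=
  ∀ d : E, ∀ δ : ℝ, 0 < δ → ∃ t : ℝ, 0 < t ∧ ‖u + t • d‖ + ‖u - t • d‖ - 2 * ‖u‖ < t * δ

/-! ### Smooth points and separated norming functionals -/

section Smooth

variable {E : Type*} [NormedAddCommGroup E] [NormedSpace ℝ E]

theorem isOpen_setOf_smooth_in_direction (d : E) (δ : ℝ) :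
    IsOpen {u : E | ∃ t : ℝ, 0 < t ∧ ‖u + t • d‖ + ‖u - t • d‖ - 2 * ‖u‖ < t * δ} := by
  have : {u : E | ∃ t : ℝ, 0 < t ∧ ‖u + t • d‖ + ‖u - t • d‖ - 2 * ‖u‖ < t * δ} =
      ⋃ t : {t : ℝ // 0 < t}, {u : E | ‖u + t.1 • d‖ + ‖u - t.1 • d‖ - 2 * ‖u‖ < t * δ} := by
    ext u; simp
  rw [this]
  exact isOpen_iUnion fun t => isOpen_lt (by fun_prop) (by fun_prop)

/-- The derivatives of `t ↦ h (s + t)` and `t ↦ h (s - t)` at 0 cancel, so the second difference is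
`o(t)`. -/
theorem exists_second_difference_lt {h : ℝ → ℝ} {s : ℝ} (hs : DifferentiableAt ℝ h s) {δ : ℝ}
    (hδ : 0 < δ) : ∃ t : ℝ, 0 < t ∧ h (s + t) + h (s - t) - 2 * h s < t * δ := by
  have h1 : HasDerivAt (fun t : ℝ => h (s + t)) (deriv h s) 0 := by
    have := hs.hasDerivAt
    apply HasDerivAt.comp_const_add
    simpa using this
  have h2 : HasDerivAt (fun t : ℝ => h (s - t)) (-deriv h s) 0 := by
    have := hs.hasDerivAt
    apply HasDerivAt.comp_const_sub
    simpa using this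
  have h3 := (h1.add h2).isLittleO.def (half_pos hδ)
  have h4 : ∀ᶠ t in nhdsWithin (0 : ℝ) (Set.Ioi 0), 0 < t := self_mem_nhdsWithin
  obtain ⟨t, ht, ht0⟩ := ((h3.filter_mono nhdsWithin_le_nhds).and h4).exists
  refine ⟨t, ht0, ?_⟩
  simp only [Real.norm_eq_abs, Pi.add_apply, add_zero, sub_zero, add_neg_cancel, smul_zero,
    abs_of_pos ht0] at ht
  have := (abs_le.1 ht).2
  nlinarith

/-- On each line parallel to `d` the norm is Lipschitz, hence differentiable almost everywhere. -/
theorem dense_setOf_smooth_in_direction (d : E) {δ : ℝ} (hδ : 0 < δ) :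
    Dense {u : E | ∃ t : ℝ, 0 < t ∧ ‖u + t • d‖ + ‖u - t • d‖ - 2 * ‖u‖ < t * δ} := by
  intro u
  have hlip : LipschitzWith ‖d‖₊ (fun s : ℝ => ‖u + s • d‖) := by
    refine LipschitzWith.of_dist_le_mul fun s t => ?_
    rw [Real.dist_eq, Real.dist_eq]
    refine (abs_norm_sub_norm_le _ _).trans ?_
    rw [add_sub_add_left_eq_sub, ← sub_smul, norm_smul, mul_comm]
    rfl
  have hd : Dense {s : ℝ | DifferentiableAt ℝ (fun s : ℝ => ‖u + s • d‖) s} :=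
    MeasureTheory.Measure.dense_of_ae hlip.ae_differentiableAt_real
  have hmap : Set.MapsTo (fun s : ℝ => u + s • d)
      {s : ℝ | DifferentiableAt ℝ (fun s : ℝ => ‖u + s • d‖) s}
      {u : E | ∃ t : ℝ, 0 < t ∧ ‖u + t • d‖ + ‖u - t • d‖ - 2 * ‖u‖ < t * δ} := by
    intro s hs
    obtain ⟨t, ht, h⟩ := exists_second_difference_lt hs hδ
    refine ⟨t, ht, ?_⟩
    simpa only [add_smul, sub_smul, add_assoc, add_sub_assoc] using h
  have := map_mem_closure (f := fun s : ℝ => u + s • d) (by fun_prop) (hd 0) hmap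
  simpa using this

/-- Mazur's theorem: the norm of a separable Banach space is smooth at the points of a dense
set. -/
theorem dense_setOf_isSmoothPoint [CompleteSpace E] [TopologicalSpace.SeparableSpace E] :
    Dense {u : E | IsSmoothPoint u} := by
  -- Baire category over a dense sequence of directions and the tolerances `1 / (m + 1)`.
  have h := dense_iInter_of_isOpen (f := fun p : ℕ × ℕ => {u : E | ∃ t : ℝ, 0 < t ∧
      ‖u + t • TopologicalSpace.denseSeq E p.1‖ + ‖u - t • TopologicalSpace.denseSeq E p.1‖
        - 2 * ‖u‖ < t * (1 / ((p.2 : ℝ) + 1))})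
    (fun p => isOpen_setOf_smooth_in_direction _ _)
    (fun p => dense_setOf_smooth_in_direction _ (by positivity))
  refine h.mono fun u hu d δ hδ => ?_
  obtain ⟨m, hm⟩ := exists_nat_one_div_lt (half_pos hδ)
  obtain ⟨k, hk⟩ := (TopologicalSpace.denseRange_denseSeq E).exists_dist_lt d
    (show 0 < δ / 4 by positivity)
  obtain ⟨t, ht, htu⟩ := Set.mem_iInter.1 hu (k, m)
  refine ⟨t, ht, ?_⟩
  simp only at htu
  set e := TopologicalSpace.denseSeq E k
  have hde : ‖t • (d - e)‖ ≤ t * (δ / 4) := by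
    rw [norm_smul, Real.norm_of_nonneg ht.le, ← dist_eq_norm]
    gcongr
  have h1 : ‖u + t • d‖ ≤ ‖u + t • e‖ + ‖t • (d - e)‖ := by
    have : u + t • d = (u + t • e) + t • (d - e) := by rw [smul_sub]; abel
    rw [this]; exact norm_add_le _ _
  have h2 : ‖u - t • d‖ ≤ ‖u - t • e‖ + ‖t • (d - e)‖ := by
    have : u - t • d = (u - t • e) - t • (d - e) := by rw [smul_sub]; abel
    rw [this]; exact norm_sub_le _ _
  have h3 : t * (1 / ((m : ℝ) + 1)) < t * (δ / 2) := by gcongr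
  linarith

/-- Add the bound for `ψ` at `u ± t • d` to that for `φ` at `u ∓ t • d`: smoothness caps the total,
so a discrepancy at `d` forces a loss at `u`. -/
theorem IsSmoothPoint.exists_gap {u : E} (hu : IsSmoothPoint u) {φ : StrongDual ℝ E}
    (hφ : ‖φ‖ ≤ 1) (hφu : φ u = ‖u‖) (d : E) {δ : ℝ} (hδ : 0 < δ) :
    ∃ γ : ℝ, 0 < γ ∧ ∀ ψ : StrongDual ℝ E, ‖ψ‖ ≤ 1 → δ ≤ |ψ d - φ d| → ψ u ≤ ‖u‖ - γ := by
  obtain ⟨t, ht, h⟩ := hu d (δ / 2) (half_pos hδ)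
  refine ⟨t * (δ / 2), by positivity, fun ψ hψ hd => ?_⟩
  have key : ∀ χ : StrongDual ℝ E, ‖χ‖ ≤ 1 → ∀ x, χ x ≤ ‖x‖ := fun χ hχ x =>
    (le_abs_self _).trans ((χ.le_opNorm x).trans (by nlinarith [norm_nonneg x]))
  have a1 := key ψ hψ (u + t • d)
  have a2 := key ψ hψ (u - t • d)
  have b1 := key φ hφ (u + t • d)
  have b2 := key φ hφ (u - t • d)
  simp only [map_add, map_sub, map_smul, smul_eq_mul, hφu] at a1 a2 b1 b2
  rcases le_abs.1 hd with hd | hd <;> nlinarith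

/-- The functionals of norm at most one which norm a smooth point. -/
def smoothNormingSet (E : Type*) [NormedAddCommGroup E] [NormedSpace ℝ E] :
    Set (StrongDual ℝ E) :=
  {φ | ‖φ‖ ≤ 1 ∧ ∃ u : E, IsSmoothPoint u ∧ φ u = ‖u‖}

/-- The points normed by a finite family form a closed set, and this one contains the dense set of
smooth points. -/
theorem exists_mem_smoothNormingSet_eq_norm [CompleteSpace E] [TopologicalSpace.SeparableSpace E]
    (h : (smoothNormingSet E).Finite) (x : E) : ∃ φ ∈ smoothNormingSet E, φ x = ‖x‖ := by
  have hcl : IsClosed {x : E | ∃ φ ∈ smoothNormingSet E, φ x = ‖x‖} := by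
    have : {x : E | ∃ φ ∈ smoothNormingSet E, φ x = ‖x‖} =
        ⋃ φ ∈ smoothNormingSet E, {x : E | φ x = ‖x‖} := by ext; simp
    rw [this]
    exact h.isClosed_biUnion fun φ _ => isClosed_eq φ.continuous continuous_norm
  have hsub : {u : E | IsSmoothPoint u} ⊆ {x : E | ∃ φ ∈ smoothNormingSet E, φ x = ‖x‖} := by
    intro u hu
    obtain ⟨φ, h1, h2⟩ := exists_dual_vector'' ℝ u
    exact ⟨φ, ⟨h1, u, hu, by simpa using h2⟩, by simpa using h2⟩
  exact hcl.closure_subset_iff.2 hsub (dense_setOf_isSmoothPoint x)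

theorem finiteDimensional_and_polyhedral_of_finite [CompleteSpace E]
    [TopologicalSpace.SeparableSpace E] (h : (smoothNormingSet E).Finite) :
    FiniteDimensional ℝ E ∧ HasPolyhedralUnitBall E := by
  constructor
  · have := h.to_subtype
    let L : E →ₗ[ℝ] (smoothNormingSet E → ℝ) := LinearMap.pi fun φ => φ.1.toLinearMap
    refine FiniteDimensional.of_injective L ((injective_iff_map_eq_zero L).2 fun x hx => ?_)
    obtain ⟨φ, hφ, hφx⟩ := exists_mem_smoothNormingSet_eq_norm h x
    rw [← norm_eq_zero, ← hφx]
    exact congrFun hx ⟨φ, hφ⟩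
  · refine ⟨(fun φ => (φ, (1 : ℝ))) '' smoothNormingSet E, h.image _, ?_⟩
    ext x
    simp only [mem_closedBall_zero_iff, Set.forall_mem_image, Set.mem_ofPred_eq]
    constructor
    · intro hx φ hφ
      exact (le_abs_self _).trans ((φ.le_opNorm x).trans
        (by nlinarith [norm_nonneg x, hφ.1, norm_nonneg φ]))
    · intro hx
      obtain ⟨φ, hφ, hφx⟩ := exists_mem_smoothNormingSet_eq_norm h x
      exact hφx ▸ hx hφ

theorem exists_separated_norming_sequence [CompleteSpace E]
    [TopologicalSpace.SeparableSpace E] (h : ¬ (FiniteDimensional ℝ E ∧ HasPolyhedralUnitBall E)) :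
    ∃ (φ : ℕ → StrongDual ℝ E) (b : ℕ → E), (∀ n, ‖φ n‖ ≤ 1) ∧ (∀ n, φ n (b n) = ‖b n‖) ∧
      ∀ n m, m ≠ n → φ m (b n) ≤ ‖b n‖ - 1 := by
  have hinf : (smoothNormingSet E).Infinite := fun hf =>
    h (finiteDimensional_and_polyhedral_of_finite hf)
  let X : Set (E → ℝ) := (fun φ : StrongDual ℝ E => (φ : E → ℝ)) '' smoothNormingSet E
  have : Infinite X := (hinf.image DFunLike.coe_injective.injOn).to_subtype
  -- The topology on `X` is that of pointwise convergence, so isolation of `f n` is witnessed by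
  -- finitely many vectors `d ∈ I`.
  obtain ⟨s, hs, hdisc⟩ := exists_infinite_discreteTopology X
  have := hs.to_subtype
  let f : ℕ ↪ s := Infinite.natEmbedding s
  have hf : ∀ n, ∃ φ ∈ smoothNormingSet E, (φ : E → ℝ) = (f n).1.1 := fun n => (f n).1.2
  choose φ hφ hφf using hf
  have hgap : ∀ n, ∃ b : E, φ n b = ‖b‖ ∧ ∀ m, m ≠ n → φ m b ≤ ‖b‖ - 1 := by
    intro n
    obtain ⟨hn, u, hu, hφu⟩ := hφ n
    have hopen : IsOpen ({f n} : Set s) := isOpen_discrete _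
    obtain ⟨V, hV, hVf⟩ := isOpen_induced_iff.1 hopen
    obtain ⟨W, hW, hWV⟩ := isOpen_induced_iff.1 hV
    have hmem : (f n).1.1 ∈ W := by
      have : (f n) ∈ Subtype.val ⁻¹' V := by rw [hVf]; rfl
      rw [← hWV] at this
      exact this
    obtain ⟨I, U, hU, hUW⟩ := isOpen_pi_iff.1 hW _ hmem
    have hγ : ∀ d : E, ∃ γ : ℝ, 0 < γ ∧ (d ∈ I → ∀ ψ : StrongDual ℝ E, ‖ψ‖ ≤ 1 →
        ψ d ∉ U d → ψ u ≤ ‖u‖ - γ) := by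
      intro d
      by_cases hd : d ∈ I
      · obtain ⟨δ, hδ, hball⟩ := Metric.isOpen_iff.1 (hU d hd).1 _ (hU d hd).2
        obtain ⟨γ, hγ, H⟩ := hu.exists_gap hn hφu d hδ
        refine ⟨γ, hγ, fun _ ψ hψ hψd => H ψ hψ ?_⟩
        by_contra hlt
        refine hψd (hball ?_)
        rw [Metric.mem_ball, Real.dist_eq, ← hφf]
        exact not_le.1 hlt
      · exact ⟨1, one_pos, fun h => (hd h).elim⟩
    choose γ hγ0 hγ using hγ
    obtain ⟨ε, hε, hεγ⟩ : ∃ ε : ℝ, 0 < ε ∧ ∀ d ∈ I, ε ≤ γ d := by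
      rcases I.eq_empty_or_nonempty with rfl | hI
      · exact ⟨1, one_pos, by simp⟩
      · exact ⟨I.inf' hI γ, (Finset.lt_inf'_iff _).2 fun d _ => hγ0 d,
          fun d hd => Finset.inf'_le _ hd⟩
    -- Rescaling turns the gap `ε`, which depends on `n`, into 1.
    refine ⟨ε⁻¹ • u, ?_, fun m hm => ?_⟩
    · rw [map_smul, norm_smul, hφu, smul_eq_mul, Real.norm_of_nonneg (by positivity)]
    · have : ∃ d ∈ I, φ m d ∉ U d := by
        by_contra! hall
        have h1 : (f m).1.1 ∈ W := hUW (by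
          intro d hd
          rw [← hφf]
          exact hall d hd)
        have h2 : f m ∈ ({f n} : Set s) := by
          rw [← hVf, ← hWV]; exact h1
        exact hm (f.injective h2)
      obtain ⟨d, hd, hdU⟩ := this
      have h1 := hγ d hd (φ m) (hφ m).1 hdU
      have h2 := hεγ d hd
      rw [map_smul, norm_smul, smul_eq_mul, Real.norm_of_nonneg (by positivity)]
      have h3 : φ m u ≤ ‖u‖ - ε := by linarith
      calc ε⁻¹ * φ m u ≤ ε⁻¹ * (‖u‖ - ε) := by gcongr
        _ = _ := by field_simp
  choose b hb1 hb2 using hgap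
  exact ⟨φ, b, fun n => (hφ n).1, hb1, fun n m => hb2 n m⟩

end Smooth

namespace TypeSpace

/-! ### Bounding the distance between types by functionals -/

section Realisation

variable {I : Type v} {E : Type u} [NormedAddCommGroup E] [NormedSpace ℝ E]

theorem coe_tp_apply {F : Type w} [NormedAddCommGroup F] [NormedSpace ℝ F]
    (j : E →ₗᵢ[ℝ] F) (a : I → F) (b : E) (l : I →₀ ℝ) :
    (tp j a).1 (b, l) = ‖j b + Finsupp.linearCombination ℝ a l‖ := rfl

theorem tp_eq_of_linearMap {F : Type w} [NormedAddCommGroup F] [NormedSpace ℝ F]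
    {ξ : TypeSpace I E} (j : E →ₗᵢ[ℝ] F) (L : FormalSum I E →ₗ[ℝ] F)
    (hj : ∀ b, L (b, 0) = j b) (hL : ∀ v, ‖L v‖ = ξ.1 v) :
    tp j (fun i => L (0, Finsupp.single i 1)) = ξ := by
  apply Subtype.ext
  ext ⟨b, l⟩
  rw [coe_tp_apply, ← hL]
  congr 1
  have h1 : Finsupp.linearCombination ℝ (fun i => L (0, Finsupp.single i 1)) =
      L ∘ₗ LinearMap.inr ℝ E (I →₀ ℝ) := by
    ext i
    simp
  rw [h1, ← hj]
  simp [← map_add]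

theorem abs_sub_lt_of_typeDist_lt {ξ ζ : TypeSpace I E} {r : ℝ}
    (h : typeDist ξ ζ < ENNReal.ofReal r) (b : E) (i : I) :
    |ξ.1 (b, Finsupp.single i 1) - ζ.1 (b, Finsupp.single i 1)| < r := by
  obtain ⟨s, ⟨F, _, _, _, j, x, y, rfl, rfl, rfl⟩, hs⟩ := sInf_lt_iff.1 h
  have h1 : ‖x i - y i‖ₑ < ENNReal.ofReal r :=
    (le_iSup (fun i => ‖x i - y i‖ₑ) i).trans_lt hs
  rw [← ofReal_norm, ENNReal.ofReal_lt_ofReal_iff_of_nonneg (norm_nonneg _)] at h1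
  rw [coe_tp_apply, coe_tp_apply]
  refine lt_of_le_of_lt (abs_norm_sub_norm_le _ _) ?_
  simpa using h1

/-- The pairs of linear functionals on `E(I)` dominated respectively by `ξ` and `ζ`, which agree
on `E` and whose values at each of the variables are within `r`. -/
def closeFunctionals (ξ ζ : TypeSpace I E) (r : ℝ) :
    Set (Module.Dual ℝ (FormalSum I E) × Module.Dual ℝ (FormalSum I E)) :=
  {p | (∀ v, p.1 v ≤ ξ.1 v) ∧ (∀ v, p.2 v ≤ ζ.1 v) ∧ (∀ b : E, p.1 (b, 0) = p.2 (b, 0)) ∧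
    ∀ i, |p.1 (0, Finsupp.single i 1) - p.2 (0, Finsupp.single i 1)| ≤ r}

theorem abs_le_of_forall_le {V : Type*} [AddCommGroup V] [Module ℝ V] {p : Seminorm ℝ V}
    {g : Module.Dual ℝ V} (h : ∀ v, g v ≤ p v) (v : V) : |g v| ≤ p v := by
  refine abs_le.2 ⟨?_, h v⟩
  have := h (-v)
  rw [map_neg, map_neg_eq_map] at this
  linarith

theorem exists_isometry_of_functionals {V : Type*} [AddCommGroup V] [Module ℝ V]
    {J : Type*} [TopologicalSpace J] [DiscreteTopology J] (p : Seminorm ℝ V)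
    (g : J → Module.Dual ℝ V) (h : ∀ k v, g k v ≤ p v) (h' : ∀ v, ∃ k, g k v = p v) :
    ∃ L : V →ₗ[ℝ] BoundedContinuousFunction J ℝ, (∀ v k, L v k = g k v) ∧ ∀ v, ‖L v‖ = p v := by
  let L : V →ₗ[ℝ] BoundedContinuousFunction J ℝ :=
    { toFun := fun v => BoundedContinuousFunction.ofNormedAddCommGroupDiscrete (fun k => g k v)
        (p v) (fun k => abs_le_of_forall_le (h k) v)
      map_add' := fun v w => by ext k; simp
      map_smul' := fun c v => by ext k; simp }
  refine ⟨L, fun v k => rfl, fun v => le_antisymm ?_ ?_⟩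
  · exact (BoundedContinuousFunction.norm_le (apply_nonneg p v)).2
      fun k => abs_le_of_forall_le (h k) v
  · obtain ⟨k, hk⟩ := h' v
    rw [← hk]
    exact (le_abs_self _).trans ((L v).norm_coe_le_norm k)

/-- Evaluation at all pairs sends both types into one `ℓ^∞` space. Agreement of each pair on `E`
makes the two copies of `E` coincide. -/
theorem typeDist_le_of_closeFunctionals {ξ ζ : TypeSpace I E} {r : ℝ}
    (h₁ : ∀ v, ∃ p ∈ closeFunctionals ξ ζ r, p.1 v = ξ.1 v)
    (h₂ : ∀ v, ∃ p ∈ closeFunctionals ξ ζ r, p.2 v = ζ.1 v) :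
    typeDist ξ ζ ≤ ENNReal.ofReal r := by
  let _ : TopologicalSpace (closeFunctionals ξ ζ r) := ⊥
  have : DiscreteTopology (closeFunctionals ξ ζ r) := ⟨rfl⟩
  obtain ⟨L₁, hL₁, hn₁⟩ := exists_isometry_of_functionals ξ.1
    (fun p : closeFunctionals ξ ζ r => p.1.1) (fun p => p.2.1)
    (fun v => by obtain ⟨p, hp, h⟩ := h₁ v; exact ⟨⟨p, hp⟩, h⟩)
  obtain ⟨L₂, hL₂, hn₂⟩ := exists_isometry_of_functionals ζ.1
    (fun p : closeFunctionals ξ ζ r => p.1.2) (fun p => p.2.2.1)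
    (fun v => by obtain ⟨p, hp, h⟩ := h₂ v; exact ⟨⟨p, hp⟩, h⟩)
  have hr : 0 ≤ r ∨ IsEmpty I := by
    obtain ⟨p, hp, -⟩ := h₁ 0
    rcases isEmpty_or_nonempty I with hI | ⟨⟨i⟩⟩
    · exact Or.inr hI
    · exact Or.inl ((abs_nonneg _).trans (hp.2.2.2 i))
  let j : E →ₗᵢ[ℝ] BoundedContinuousFunction (closeFunctionals ξ ζ r) ℝ :=
    ⟨L₁ ∘ₗ LinearMap.inl ℝ E (I →₀ ℝ), fun b => (hn₁ (b, 0)).trans (ξ.2 b)⟩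
  have hle : ⨆ i, ‖L₁ (0, Finsupp.single i 1) - L₂ (0, Finsupp.single i 1)‖ₑ ≤
      ENNReal.ofReal r := by
    refine iSup_le fun i => ?_
    rcases hr with hr | hI
    · rw [← ofReal_norm]
      refine ENNReal.ofReal_le_ofReal ((BoundedContinuousFunction.norm_le hr).2 fun p => ?_)
      rw [BoundedContinuousFunction.sub_apply, hL₁, hL₂]
      exact p.2.2.2.2 i
    · exact hI.elim i
  refine (sInf_le ?_).trans hle
  refine ⟨_, _, _, inferInstance, j, _, _, tp_eq_of_linearMap j L₁ (fun b => rfl) hn₁,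
    tp_eq_of_linearMap j L₂ (fun b => ?_) hn₂, rfl⟩
  ext p
  change L₂ (b, 0) p = L₁ (b, 0) p
  rw [hL₁, hL₂]
  exact (p.2.2.2.1 b).symm

theorem exists_dual_eq_seminorm {V : Type*} [AddCommGroup V] [Module ℝ V] (p : Seminorm ℝ V)
    (v : V) : ∃ g : Module.Dual ℝ V, (∀ w, g w ≤ p w) ∧ g v = p v := by
  -- Makes the functional on the span of `v` well defined even when `v = 0`.
  have H : ∀ c : ℝ, c • v = 0 → c • p v = 0 := by
    intro c hc
    rcases smul_eq_zero.1 hc with rfl | rfl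
    · exact zero_smul _ _
    · rw [map_zero, smul_zero]
  obtain ⟨g, hg, hgp⟩ := exists_extension_of_le_sublinear
    (LinearPMap.mkSpanSingleton' (σ := RingHom.id ℝ) v (p v) H) p
    (fun c hc x => by rw [map_smul_eq_mul, Real.norm_of_nonneg hc.le]) (map_add_le_add p) (by
      rintro ⟨x, hx⟩
      obtain ⟨c, rfl⟩ := Submodule.mem_span_singleton.1 hx
      rw [LinearPMap.mkSpanSingleton'_apply, map_smul_eq_mul, RingHom.id_apply, smul_eq_mul]
      gcongr
      exact le_abs_self c)
  refine ⟨g, hgp, ?_⟩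
  exact (hg ⟨v, Submodule.mem_span_singleton_self v⟩).trans
    (LinearPMap.mkSpanSingleton'_apply_self (σ := RingHom.id ℝ) v (p v) H _)

theorem typeDist_self (ξ : TypeSpace I E) : typeDist ξ ξ = 0 := by
  rw [← nonpos_iff_eq_zero, ← ENNReal.ofReal_zero]
  have h : ∀ v, ∃ p ∈ closeFunctionals ξ ξ 0, p.1 v = ξ.1 v ∧ p.2 v = ξ.1 v := by
    intro v
    obtain ⟨g, hg, hv⟩ := exists_dual_eq_seminorm ξ.1 v
    exact ⟨(g, g), ⟨hg, hg, fun _ => rfl, fun i => by simp⟩, hv, hv⟩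
  exact typeDist_le_of_closeFunctionals
    (fun v => (h v).imp fun _ hp => ⟨hp.1, hp.2.1⟩) (fun v => (h v).imp fun _ hp => ⟨hp.1, hp.2.2⟩)

theorem isMetricallyDense_univ : IsMetricallyDense (Set.univ : Set (TypeSpace I E)) :=
  fun ξ _ hε => ⟨ξ, Set.mem_univ _, (typeDist_self ξ).symm ▸ hε⟩

end Realisation

/-! ### Continuum many separated types, and the cardinality bound -/

section LowerBound

variable {E : Type u} [NormedAddCommGroup E] [NormedSpace ℝ E]

open BoundedContinuousFunction in
/-- The isometric embedding `b ↦ (b, (φ m b)_{m ∈ S})` of `E` into `E × ℓ^∞(S)`. -/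
noncomputable def graphEmbedding (φ : ℕ → StrongDual ℝ E) (hφ : ∀ n, ‖φ n‖ ≤ 1) (S : Set ℕ) :
    E →ₗᵢ[ℝ] E × (BoundedContinuousFunction S ℝ) where
  toFun b := (b, ofNormedAddCommGroupDiscrete (fun m : S => φ m b) ‖b‖
    fun m => (φ m).le_of_opNorm_le (hφ m) b |>.trans_eq (one_mul _))
  map_add' b c := by ext <;> simp
  map_smul' r b := by ext <;> simp
  norm_map' b := by
    refine max_eq_left ((BoundedContinuousFunction.norm_le (norm_nonneg b)).2 fun m => ?_)
    exact (φ m).le_of_opNorm_le (hφ m) b |>.trans_eq (one_mul _)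

theorem graphEmbedding_snd_apply (φ : ℕ → StrongDual ℝ E) (hφ : ∀ n, ‖φ n‖ ≤ 1) (S : Set ℕ)
    (b : E) (m : S) : (graphEmbedding φ hφ S b).2 m = φ m b := rfl

/-- The type over `E` of the constant family `(0, 1)` in `E × ℓ^∞(S)`. -/
noncomputable def graphType (I : Type v) (φ : ℕ → StrongDual ℝ E) (hφ : ∀ n, ‖φ n‖ ≤ 1)
    (S : Set ℕ) : TypeSpace I E :=
  tp (graphEmbedding φ hφ S) (fun _ => (0, 1))

theorem graphType_single {I : Type v} (φ : ℕ → StrongDual ℝ E) (hφ : ∀ n, ‖φ n‖ ≤ 1)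
    (S : Set ℕ) (b : E) (i : I) : (graphType I φ hφ S).1 (b, Finsupp.single i 1) =
      max ‖b‖ ‖(graphEmbedding φ hφ S b).2 + 1‖ := by
  rw [graphType, coe_tp_apply, Finsupp.linearCombination_single, one_smul, Prod.norm_def]
  simp [graphEmbedding]

theorem le_graphType_of_mem {I : Type v} {φ : ℕ → StrongDual ℝ E} {hφ : ∀ n, ‖φ n‖ ≤ 1}
    {S : Set ℕ} {n : ℕ} (hn : n ∈ S) {b : E} (hb : φ n b = ‖b‖) (i : I) :
    ‖b‖ + 1 ≤ (graphType I φ hφ S).1 (b, Finsupp.single i 1) := by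
  rw [graphType_single]
  refine le_max_of_le_right ?_
  refine le_trans ?_ (((graphEmbedding φ hφ S b).2 + 1).norm_coe_le_norm ⟨n, hn⟩)
  rw [BoundedContinuousFunction.add_apply, graphEmbedding_snd_apply, hb]
  exact le_abs_self _

theorem graphType_le_of_notMem {I : Type v} {φ : ℕ → StrongDual ℝ E} {hφ : ∀ n, ‖φ n‖ ≤ 1}
    {S : Set ℕ} {n : ℕ} (hn : n ∉ S) {b : E} (hb : ∀ m, m ≠ n → φ m b ≤ ‖b‖ - 1) (i : I) :
    (graphType I φ hφ S).1 (b, Finsupp.single i 1) ≤ ‖b‖ := by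
  rw [graphType_single]
  refine max_le le_rfl ((BoundedContinuousFunction.norm_le (norm_nonneg b)).2 fun m => ?_)
  rw [BoundedContinuousFunction.add_apply, graphEmbedding_snd_apply]
  have h1 := hb m (fun h => hn (h ▸ m.2))
  have h2 := abs_le.1 ((φ m).le_of_opNorm_le (hφ m) b)
  refine abs_le.2 ⟨?_, ?_⟩ <;> simp <;> linarith [h2.1]

theorem continuum_le_of_isMetricallyDense [CompleteSpace E] [TopologicalSpace.SeparableSpace E]
    (h : ¬ (FiniteDimensional ℝ E ∧ HasPolyhedralUnitBall E)) {I : Type} (i : I)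
    {D : Set (TypeSpace I E)} (hD : IsMetricallyDense D) : 𝔠 ≤ #D := by
  obtain ⟨φ, b, hφ, hb, hsep⟩ := exists_separated_norming_sequence h
  -- Types of distinct sets differ by at least 1 at some `b n + x`, so balls of radius `1 / 2`
  -- cannot share a point of `D`.
  have hD' := fun S : Set ℕ => hD (graphType I φ hφ S) (ENNReal.ofReal (1 / 2)) (by simp)
  choose f hfD hf using hD'
  have key : ∀ S T : Set ℕ, f S = f T → S ⊆ T := by
    intro S T hST n hnS
    by_contra hnT
    have h1 := le_graphType_of_mem (I := I) (hφ := hφ) hnS (hb n) i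
    have h2 := graphType_le_of_notMem (I := I) (hφ := hφ) hnT (hsep n) i
    have h3 := abs_lt.1 (abs_sub_lt_of_typeDist_lt (hf S) (b n) i)
    have h4 := abs_lt.1 (abs_sub_lt_of_typeDist_lt (hf T) (b n) i)
    rw [← hST] at h4
    linarith [h3.2, h4.1]
  have hinj : Function.Injective (fun S => (⟨f S, hfD S⟩ : D)) := fun S T hST => by
    have := congrArg Subtype.val hST
    exact (key S T this).antisymm (key T S this.symm)
  have := Cardinal.lift_mk_le_lift_mk_of_injective hinj
  simpa using this

theorem apply_le_norm_add_sum {I : Type v} [Fintype I] (ξ : TypeSpace I E) (b : E) (l : I →₀ ℝ) :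
    ξ.1 (b, l) ≤ ‖b‖ + ∑ i, |l i| * ξ.1 (0, Finsupp.single i 1) := by
  have h1 : (b, l) = (b, (0 : I →₀ ℝ)) + ∑ i, l i • ((0 : E), Finsupp.single i (1 : ℝ)) := by
    classical
    ext i
    · simp [Prod.fst_sum]
    · simp [Prod.snd_sum]
  rw [h1]
  refine (map_add_le_add ξ.1 _ _).trans ?_
  rw [ξ.2]
  gcongr
  refine (Finset.le_sum_of_subadditive ξ.1 (map_zero _).le (map_add_le_add ξ.1) _
    _).trans (Finset.sum_le_sum fun i _ => ?_)
  rw [map_smul_eq_mul, Real.norm_eq_abs]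

theorem continuous_apply_equivFunOnFinite_symm {I : Type v} [Fintype I] (ξ : TypeSpace I E) :
    Continuous fun x : E × (I → ℝ) => ξ.1 (x.1, Finsupp.equivFunOnFinite.symm x.2) := by
  let C : NNReal := 1 + ∑ i, (ξ.1 (0, Finsupp.single i 1)).toNNReal
  let p : Seminorm ℝ (E × (I → ℝ)) := ξ.1.comp
    (LinearMap.id.prodMap (Finsupp.linearEquivFunOnFinite ℝ ℝ I).symm.toLinearMap)
  have hp : p ≤ C • normSeminorm ℝ (E × (I → ℝ)) := by
    intro x
    refine (apply_le_norm_add_sum ξ _ _).trans ?_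
    change _ ≤ ((1 + ∑ i, (ξ.1 (0, Finsupp.single i 1)).toNNReal : NNReal) : ℝ)
      * ‖x‖
    rw [NNReal.coe_add, NNReal.coe_one, NNReal.coe_sum, add_mul, one_mul, Finset.sum_mul]
    refine add_le_add (norm_fst_le x) (Finset.sum_le_sum fun i _ => ?_)
    rw [mul_comm, Real.coe_toNNReal _ (apply_nonneg _ _)]
    exact mul_le_mul_of_nonneg_left ((norm_le_pi_norm x.2 i).trans (norm_snd_le x))
      (apply_nonneg _ _)
  have hC : Continuous (C • normSeminorm ℝ (E × (I → ℝ))) :=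
    (continuous_norm (E := E × (I → ℝ))).const_smul C
  exact Seminorm.continuous_of_le hC hp

/-- A type is continuous, hence determined by its values on a countable dense set. -/
theorem mk_typeSpace_le_continuum [TopologicalSpace.SeparableSpace E] (n : ℕ) :
    #(TypeSpace (Fin n) E) ≤ 𝔠 := by
  let f : TypeSpace (Fin n) E → (ℕ × (Fin n → ℚ)) → ℝ := fun ξ k =>
    ξ.1 (TopologicalSpace.denseSeq E k.1, Finsupp.equivFunOnFinite.symm fun i => (k.2 i : ℝ))
  have hf : Function.Injective f := by
    intro ξ ζ h
    have hd : DenseRange fun k : ℕ × (Fin n → ℚ) =>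
        (TopologicalSpace.denseSeq E k.1, fun i => (k.2 i : ℝ)) :=
      (TopologicalSpace.denseRange_denseSeq E).prodMap
        (DenseRange.piMap fun _ => Rat.denseRange_cast)
    have := hd.equalizer (continuous_apply_equivFunOnFinite_symm ξ)
      (continuous_apply_equivFunOnFinite_symm ζ) h
    apply Subtype.ext
    ext ⟨b, l⟩
    simpa using congrFun this (b, Finsupp.equivFunOnFinite l)
  have h1 := Cardinal.lift_mk_le_lift_mk_of_injective hf
  have h2 : #((ℕ × (Fin n → ℚ)) → ℝ) ≤ 𝔠 := by
    rw [← Cardinal.power_def, Cardinal.mk_real]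
    calc 𝔠 ^ #(ℕ × (Fin n → ℚ)) ≤ 𝔠 ^ Cardinal.aleph0 :=
          Cardinal.power_le_power_left Cardinal.continuum_ne_zero Cardinal.mk_le_aleph0
      _ = 𝔠 := Cardinal.continuum_power_aleph0
  simpa using h1.trans (Cardinal.lift_le.2 h2)

theorem metricDensityCharacter_eq_continuum [CompleteSpace E] [TopologicalSpace.SeparableSpace E]
    (h : ¬ (FiniteDimensional ℝ E ∧ HasPolyhedralUnitBall E)) {n : ℕ} (hn : 1 ≤ n) :
    metricDensityCharacter (Fin n) E = 𝔠 := by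
  apply le_antisymm
  · refine (csInf_le' ⟨Set.univ, isMetricallyDense_univ, rfl⟩ :
      metricDensityCharacter (Fin n) E ≤ #(Set.univ : Set (TypeSpace (Fin n) E))).trans ?_
    rw [Cardinal.mk_univ]
    exact mk_typeSpace_le_continuum n
  · refine le_csInf ⟨_, Set.univ, isMetricallyDense_univ, rfl⟩ ?_
    rintro κ ⟨D, hD, rfl⟩
    exact continuum_le_of_isMetricallyDense h ⟨0, hn⟩ hD

end LowerBound

end TypeSpace

/-! ### Hahn–Banach extension and polyhedral norms -/

theorem exists_extension_of_injective {E V : Type*} [AddCommGroup E] [Module ℝ E] [AddCommGroup V]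
    [Module ℝ V] (Φ : E →ₗ[ℝ] V) (hΦ : Function.Injective Φ) (g : E →ₗ[ℝ] ℝ) (N : V → ℝ)
    (N_hom : ∀ c : ℝ, 0 < c → ∀ x, N (c • x) = c * N x) (N_add : ∀ x y, N (x + y) ≤ N x + N y)
    (hg : ∀ b, g b ≤ N (Φ b)) : ∃ G : V →ₗ[ℝ] ℝ, (∀ b, G (Φ b) = g b) ∧ ∀ v, G v ≤ N v := by
  obtain ⟨G, hG, hGN⟩ := exists_extension_of_le_sublinear
    ⟨LinearMap.range Φ, g ∘ₗ (LinearEquiv.ofInjective Φ hΦ).symm.toLinearMap⟩ N N_hom N_add (by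
      rintro ⟨_, b, rfl⟩
      have : (LinearEquiv.ofInjective Φ hΦ).symm ⟨Φ b, b, rfl⟩ = b :=
        (LinearEquiv.symm_apply_eq _).2 rfl
      change g ((LinearEquiv.ofInjective Φ hΦ).symm ⟨Φ b, b, rfl⟩) ≤ _
      rw [this]
      exact hg b)
  refine ⟨G, fun b => ?_, hGN⟩
  have : (LinearEquiv.ofInjective Φ hΦ).symm ⟨Φ b, b, rfl⟩ = b :=
    (LinearEquiv.symm_apply_eq _).2 rfl
  refine (hG ⟨Φ b, b, rfl⟩).trans ?_
  change g ((LinearEquiv.ofInjective Φ hΦ).symm ⟨Φ b, b, rfl⟩) = _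
  rw [this]

/-- The norm is the maximum of the family `φ` of linear functionals. -/
def IsNormMax {κ : Type*} {E : Type*} [NormedAddCommGroup E] [NormedSpace ℝ E]
    (φ : κ → Module.Dual ℝ E) : Prop :=
  (∀ b k, φ k b ≤ ‖b‖) ∧ ∀ b, ∃ k, φ k b = ‖b‖

section Polyhedral

variable {E : Type u} [NormedAddCommGroup E] [NormedSpace ℝ E]

theorem HasPolyhedralUnitBall.exists_isNormMax (h : HasPolyhedralUnitBall E) :
    ∃ (κ : Type u) (_ : Fintype κ) (_ : Nonempty κ) (φ : κ → Module.Dual ℝ E), IsNormMax φ := by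
  obtain ⟨T, hT, hball⟩ := h
  have hmem : ∀ x : E, ‖x‖ ≤ 1 ↔ ∀ h ∈ T, h.1 x ≤ h.2 := fun x => by
    rw [← mem_closedBall_zero_iff, hball]; rfl
  have hnn : ∀ h ∈ T, 0 ≤ h.2 := fun h hh => by
    simpa using (hmem 0).1 (by simp) h hh
  have hle : ∀ h ∈ T, ∀ b : E, h.1 b ≤ h.2 * ‖b‖ := by
    intro h hh b
    rcases eq_or_ne b 0 with rfl | hb
    · simp
    · have hb' := norm_pos_iff.2 hb
      have := (hmem (‖b‖⁻¹ • b)).1 (by rw [norm_smul, norm_inv, norm_norm,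
        inv_mul_cancel₀ hb'.ne']) h hh
      rw [map_smul, smul_eq_mul, inv_mul_le_iff₀ hb'] at this
      linarith
  let T' : Set (StrongDual ℝ E × ℝ) := {h ∈ T | 0 < h.2}
  have hT' : T'.Finite := hT.subset fun _ h => h.1
  have := hT'.fintype
  -- The extra zero functional keeps the index type nonempty and makes the maximum below
  -- nonnegative.
  let φ : Option T' → Module.Dual ℝ E := fun k =>
    k.elim 0 fun h => h.1.2⁻¹ • h.1.1.toLinearMap
  have hφ : ∀ b k, φ k b ≤ ‖b‖ := by
    rintro b (_ | ⟨h, hT, hpos⟩)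
    · exact norm_nonneg b
    · change h.2⁻¹ * h.1 b ≤ ‖b‖
      rw [inv_mul_le_iff₀ hpos]
      exact hle h hT b
  refine ⟨Option T', inferInstance, inferInstance, φ, hφ, fun b => ?_⟩
  by_contra! hne
  have hlt : ∀ k, φ k b < ‖b‖ := fun k => lt_of_le_of_ne (hφ b k) (hne k)
  obtain ⟨k₀, -, hk₀⟩ := Finset.exists_max_image Finset.univ (fun k => φ k b) Finset.univ_nonempty
  -- If nothing norms `b`, then `r⁻¹ • b` satisfies every inequality although its norm exceeds 1.
  obtain ⟨r, hr, hrb⟩ := exists_between (hlt k₀)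
  have hr0 : 0 < r := lt_of_le_of_lt (hk₀ none (Finset.mem_univ _)) hr
  have : ‖r⁻¹ • b‖ ≤ 1 := by
    rw [hmem]
    intro h hh
    rw [map_smul, smul_eq_mul, inv_mul_le_iff₀ hr0]
    rcases (hnn h hh).eq_or_lt with h0 | h0
    · have := hle h hh b
      rw [← h0] at this ⊢
      linarith
    · have h1 : h.2⁻¹ * h.1 b ≤ φ k₀ b := hk₀ (some ⟨h, hh, h0⟩) (Finset.mem_univ _)
      have h2 : h.2⁻¹ * h.1 b ≤ r := h1.trans hr.le
      rw [inv_mul_le_iff₀ h0] at h2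
      linarith
  rw [norm_smul, norm_inv, Real.norm_of_nonneg hr0.le, inv_mul_le_iff₀ hr0] at this
  linarith

variable {κ : Type*} [Fintype κ] {φ : κ → Module.Dual ℝ E}

theorem IsNormMax.sum_le_norm (hφ : IsNormMax φ) {c : κ → ℝ} (hc : c ∈ stdSimplex ℝ κ) (b : E) :
    ∑ k, c k * φ k b ≤ ‖b‖ :=
  calc ∑ k, c k * φ k b ≤ ∑ k, c k * ‖b‖ :=
        Finset.sum_le_sum fun k _ => mul_le_mul_of_nonneg_left (hφ.1 b k) (hc.1 k)
    _ = ‖b‖ := by rw [← Finset.sum_mul, hc.2, one_mul]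

/-- Extend `g` to `ℝ^κ` below the sublinear map `max`. Testing on `-e_k`, `1` and `-1` shows that
functionals below `max` are exactly simplex points. -/
theorem IsNormMax.exists_mem_stdSimplex [Nonempty κ] (hφ : IsNormMax φ) {g : Module.Dual ℝ E}
    (hg : ∀ b, g b ≤ ‖b‖) : ∃ c ∈ stdSimplex ℝ κ, ∀ b, g b = ∑ k, c k * φ k b := by
  classical
  have hne : (Finset.univ : Finset κ).Nonempty := Finset.univ_nonempty
  obtain ⟨G, hG, hGN⟩ := exists_extension_of_injective (LinearMap.pi φ)
    ((injective_iff_map_eq_zero _).2 fun b hb => by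
      obtain ⟨k, hk⟩ := hφ.2 b
      rw [← norm_eq_zero, ← hk]
      exact congrFun hb k) g
    (fun y : κ → ℝ => Finset.univ.sup' hne y)
    (fun c hc y => by
      refine le_antisymm (Finset.sup'_le _ _ fun k hk => ?_) ?_
      · exact mul_le_mul_of_nonneg_left (Finset.le_sup' y hk) hc.le
      · obtain ⟨k, hk, h⟩ := Finset.exists_mem_eq_sup' hne y
        rw [h]
        exact Finset.le_sup' (c • y) hk)
    (fun x y => Finset.sup'_le _ _ fun k hk =>
      add_le_add (Finset.le_sup' x hk) (Finset.le_sup' y hk))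
    (fun b => by
      obtain ⟨k, hk⟩ := hφ.2 b
      refine (hg b).trans ?_
      rw [← hk]
      exact Finset.le_sup' (LinearMap.pi φ b) (Finset.mem_univ k))
  have hexp : ∀ y : κ → ℝ, G y = ∑ k, G (Pi.single k 1) * y k := by
    intro y
    conv_lhs => rw [pi_eq_sum_univ' y, map_sum]
    refine Finset.sum_congr rfl fun k _ => ?_
    rw [map_smul, smul_eq_mul, mul_comm]
  refine ⟨fun k => G (Pi.single k 1), ⟨fun k => ?_, le_antisymm ?_ ?_⟩, fun b => ?_⟩
  · have h := hGN (-Pi.single k 1)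
    rw [map_neg] at h
    have h0 : Finset.univ.sup' hne (-Pi.single k (1 : ℝ)) ≤ 0 := Finset.sup'_le _ _ fun m _ => by
      rw [Pi.neg_apply, neg_nonpos, Pi.single_apply]
      split_ifs <;> norm_num
    linarith
  · have h := (hGN 1).trans (Finset.sup'_le hne _ fun k _ => le_refl (1 : ℝ))
    rw [hexp] at h
    simpa using h
  · have h := (hGN (-1)).trans (Finset.sup'_le hne _ fun k _ => le_refl (-1 : ℝ))
    rw [map_neg, hexp] at h
    simpa using h
  · rw [← hG, hexp]
    rfl

end Polyhedral

/-! ### Multiplicative comparison in the simplex -/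

theorem exists_countable_comparable_in_stdSimplex (κ : Type*) [Fintype κ] :
    ∃ C ⊆ stdSimplex ℝ κ, C.Countable ∧ ∀ c ∈ stdSimplex ℝ κ, ∀ η : ℝ, 0 < η →
      ∃ d ∈ C, (∀ k, (1 - η) * d k ≤ c k) ∧ ∀ k, (1 - η) * c k ≤ d k := by
  -- For small `η` comparability forces equal supports, so a dense set is chosen for each support
  -- separately.
  have hsep : ∀ A : Set κ, ∃ t ⊆ {c ∈ stdSimplex ℝ κ | ∀ k, c k ≠ 0 ↔ k ∈ A},
      t.Countable ∧ {c ∈ stdSimplex ℝ κ | ∀ k, c k ≠ 0 ↔ k ∈ A} ⊆ closure t := fun A =>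
    (TopologicalSpace.IsSeparable.of_separableSpace _).exists_countable_dense_subset
  choose t hts htc htd using hsep
  refine ⟨⋃ A, t A, Set.iUnion_subset fun A c hc => (hts A hc).1, Set.countable_iUnion htc,
    fun c hc η hη => ?_⟩
  let A : Set κ := {k | c k ≠ 0}
  let O : Set (κ → ℝ) := {x | ∀ k, c k ≠ 0 → (1 - η) * x k < c k ∧ (1 - η) * c k < x k}
  have hO : IsOpen O := by
    have : O = ⋂ k, {x | c k ≠ 0 → (1 - η) * x k < c k ∧ (1 - η) * c k < x k} := by
      ext; simp [O]
    rw [this]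
    refine isOpen_iInter_of_finite fun k => ?_
    by_cases hk : c k = 0
    · simp [hk]
    · simp only [ne_eq, hk, not_false_eq_true, true_imp_iff]
      exact (isOpen_lt (f := fun x : κ → ℝ => (1 - η) * x k) (by fun_prop) (by fun_prop)).inter
        (isOpen_lt (g := fun x : κ → ℝ => x k) (by fun_prop) (by fun_prop))
  have hcO : c ∈ O := fun k hk => by
    have := (hc.1 k).lt_of_ne' hk
    constructor <;> nlinarith
  obtain ⟨d, hdO, hd⟩ := mem_closure_iff.1 (htd A ⟨hc, fun k => Iff.rfl⟩) O hO hcO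
  have hzero : ∀ k, c k = 0 → d k = 0 := fun k hk => by
    by_contra hne
    exact ((hts A hd).2 k).1 hne hk
  refine ⟨d, Set.mem_iUnion.2 ⟨A, hd⟩, fun k => ?_, fun k => ?_⟩
  · by_cases hk : c k = 0
    · simp [hzero k hk, hk]
    · exact (hdO k hk).1.le
  · by_cases hk : c k = 0
    · simp [hzero k hk, hk]
    · exact (hdO k hk).2.le

theorem exists_mem_stdSimplex_eq_add {κ : Type*} [Fintype κ] {c d : κ → ℝ}
    (hc : c ∈ stdSimplex ℝ κ) (hd : d ∈ stdSimplex ℝ κ) {η : ℝ} (hη : 0 < η)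
    (h : ∀ k, (1 - η) * c k ≤ d k) : ∃ e ∈ stdSimplex ℝ κ, d = (1 - η) • c + η • e := by
  refine ⟨fun k => η⁻¹ * (d k - (1 - η) * c k), ⟨fun k => ?_, ?_⟩, ?_⟩
  · have := h k
    exact mul_nonneg (by positivity) (by linarith)
  · rw [← Finset.mul_sum, Finset.sum_sub_distrib, ← Finset.mul_sum, hc.2, hd.2]
    field_simp
    ring
  · ext k
    simp only [Pi.add_apply, Pi.smul_apply, smul_eq_mul]
    field_simp
    ring

namespace TypeSpace

variable {I : Type v} {E : Type u} [NormedAddCommGroup E] [NormedSpace ℝ E]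

/-! ### Dual sets of types, finite nets and separability -/

section Pairing

variable {κ : Type*} [Fintype κ] [Fintype I]

/-- The linear functional `(b, l) ↦ ∑ k, c k * φ k b + ∑ i, t i * l i` on `E(I)`, as a function
of `(c, t)`. -/
noncomputable def pairing (I : Type v) [Fintype I] (φ : κ → Module.Dual ℝ E) :
    (κ → ℝ) × (I → ℝ) →ₗ[ℝ] Module.Dual ℝ (FormalSum I E) :=
  (Fintype.linearCombination ℝ fun k => φ k ∘ₗ LinearMap.fst ℝ E (I →₀ ℝ)).coprod
    (Fintype.linearCombination ℝ fun i => Finsupp.lapply i ∘ₗ LinearMap.snd ℝ E (I →₀ ℝ))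

theorem pairing_apply (φ : κ → Module.Dual ℝ E) (x : (κ → ℝ) × (I → ℝ)) (v : FormalSum I E) :
    pairing I φ x v = ∑ k, x.1 k * φ k v.1 + ∑ i, x.2 i * v.2 i := by
  simp [pairing, Fintype.linearCombination_apply]

theorem pairing_single (φ : κ → Module.Dual ℝ E) (x : (κ → ℝ) × (I → ℝ)) (i : I) :
    pairing I φ x (0, Finsupp.single i 1) = x.2 i := by
  classical
  simp [pairing_apply, Finsupp.single_apply]

/-- The coefficients, with respect to a finite family `φ` of functionals on `E`, of the linear
functionals on `E(I)` dominated by `ξ`. -/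
def dualSet (φ : κ → Module.Dual ℝ E) (ξ : TypeSpace I E) : Set ((κ → ℝ) × (I → ℝ)) :=
  {x | x.1 ∈ stdSimplex ℝ κ ∧ ∀ v, pairing I φ x v ≤ ξ.1 v}

variable {φ : κ → Module.Dual ℝ E} {ξ ζ : TypeSpace I E}

theorem convex_dualSet : Convex ℝ (dualSet φ ξ) := by
  rintro x ⟨hx, hx'⟩ y ⟨hy, hy'⟩ a b ha hb hab
  refine ⟨convex_stdSimplex ℝ κ hx hy ha hb hab, fun v => ?_⟩
  rw [map_add, map_smul, map_smul]
  calc a * pairing I φ x v + b * pairing I φ y v ≤ a * ξ.1 v + b * ξ.1 v := by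
        gcongr
        · exact hx' v
        · exact hy' v
    _ = ξ.1 v := by rw [← add_mul, hab, one_mul]

theorem abs_snd_le_of_mem_dualSet {x : (κ → ℝ) × (I → ℝ)} (hx : x ∈ dualSet φ ξ) (i : I) :
    |x.2 i| ≤ ξ.1 (0, Finsupp.single i 1) := by
  rw [← pairing_single φ x i]
  exact abs_le_of_forall_le hx.2 _

theorem isCompact_dualSet : IsCompact (dualSet φ ξ) := by
  have h : IsCompact (stdSimplex ℝ κ ×ˢ Set.Icc (fun i => -ξ.1 (0, Finsupp.single i 1))
      fun i => ξ.1 (0, Finsupp.single i 1)) := (isCompact_stdSimplex ℝ κ).prod isCompact_Icc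
  refine h.of_isClosed_subset ?_ fun x hx => ⟨hx.1, ?_, ?_⟩
  · have : dualSet φ ξ = Prod.fst ⁻¹' stdSimplex ℝ κ ∩
        ⋂ v, {x : (κ → ℝ) × (I → ℝ) | ∑ k, x.1 k * φ k v.1 + ∑ i, x.2 i * v.2 i ≤
          ξ.1 v} := by
      ext x
      simp [dualSet, pairing_apply]
    rw [this]
    exact ((isClosed_stdSimplex ℝ κ).preimage continuous_fst).inter
      (isClosed_iInter fun v => isClosed_le (by fun_prop) continuous_const)
  · exact fun i => (abs_le.1 (abs_snd_le_of_mem_dualSet hx i)).1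
  · exact fun i => (abs_le.1 (abs_snd_le_of_mem_dualSet hx i)).2

theorem exists_mem_dualSet_of_mem_stdSimplex [Nonempty κ] (hφ : IsNormMax φ) (ξ : TypeSpace I E)
    {c : κ → ℝ} (hc : c ∈ stdSimplex ℝ κ) : ∃ t, (c, t) ∈ dualSet φ ξ := by
  classical
  obtain ⟨G, hG, hGξ⟩ := exists_extension_of_injective (LinearMap.inl ℝ E (I →₀ ℝ))
    LinearMap.inl_injective (∑ k, c k • φ k) ξ.1
    (fun a ha x => by rw [map_smul_eq_mul, Real.norm_of_nonneg ha.le]) (map_add_le_add ξ.1)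
    (fun b => by simpa [ξ.2] using hφ.sum_le_norm hc b)
  refine ⟨fun i => G (0, Finsupp.single i 1), hc, fun v => ?_⟩
  have : pairing I φ (c, fun i => G (0, Finsupp.single i 1)) = G := by
    ext i
    · simpa [pairing_apply] using (hG i).symm
    · simpa using pairing_single φ _ i
  rw [this]
  exact hGξ v

theorem exists_mem_dualSet_pairing_eq [Nonempty κ] (hφ : IsNormMax φ) (ξ : TypeSpace I E)
    (v : FormalSum I E) : ∃ x ∈ dualSet φ ξ, pairing I φ x v = ξ.1 v := by
  classical
  obtain ⟨g, hg, hgv⟩ := exists_dual_eq_seminorm ξ.1 v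
  obtain ⟨c, hc, hgc⟩ := hφ.exists_mem_stdSimplex (g := g ∘ₗ LinearMap.inl ℝ E (I →₀ ℝ))
    fun b => (hg (b, 0)).trans_eq (ξ.2 b)
  have : pairing I φ (c, fun i => g (0, Finsupp.single i 1)) = g := by
    ext i
    · simpa [pairing_apply] using (hgc i).symm
    · simpa using pairing_single φ _ i
  exact ⟨_, ⟨hc, fun w => this ▸ hg w⟩, by rw [this, hgv]⟩

/-- Write `d = (1 - η) c + η e` and mix `(c, s)` with any point of the dual set above `e`;
coordinates are bounded by `M`, so they move by at most `2 * M * η`. -/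
theorem exists_mem_dualSet_near [Nonempty κ] (hφ : IsNormMax φ) {M : ℝ}
    (hM : ∀ i, ξ.1 (0, Finsupp.single i 1) ≤ M) {c d : κ → ℝ} {s : I → ℝ}
    (hs : (c, s) ∈ dualSet φ ξ) (hd : d ∈ stdSimplex ℝ κ) {η : ℝ} (hη : 0 < η) (hη1 : η ≤ 1)
    (h : ∀ k, (1 - η) * c k ≤ d k) :
    ∃ t, (d, t) ∈ dualSet φ ξ ∧ ∀ i, |t i - s i| ≤ 2 * M * η := by
  obtain ⟨e, he, hde⟩ := exists_mem_stdSimplex_eq_add hs.1 hd hη h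
  obtain ⟨r, hr⟩ := exists_mem_dualSet_of_mem_stdSimplex hφ ξ he
  refine ⟨(1 - η) • s + η • r, ?_, fun i => ?_⟩
  · rw [hde]
    exact convex_dualSet hs hr (by linarith) hη.le (by ring)
  · have h1 := (abs_snd_le_of_mem_dualSet hs i).trans (hM i)
    have h2 := (abs_snd_le_of_mem_dualSet hr i).trans (hM i)
    have h3 : ((1 - η) • s + η • r) i - s i = η * (r i - s i) := by
      simp only [Pi.add_apply, Pi.smul_apply, smul_eq_mul]
      ring
    rw [h3, abs_mul, abs_of_pos hη]
    have h4 := abs_sub (r i) (s i)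
    nlinarith

/-- `S` is a finite net for the dual set of `ξ`: each of its members is, up to `η`, in the fibre
of the dual set over its first component, and each point of the dual set is multiplicatively
above a nearby member of `S`. -/
structure IsDualNet (φ : κ → Module.Dual ℝ E) (ξ : TypeSpace I E) (η M : ℝ)
    (S : Set ((κ → ℝ) × (I → ℝ))) : Prop where
  single_le : ∀ i, ξ.1 (0, Finsupp.single i 1) ≤ M
  near_fibre : ∀ p ∈ S, ∃ s, (p.1, s) ∈ dualSet φ ξ ∧ ∀ i, |s i - p.2 i| ≤ η
  covers : ∀ x ∈ dualSet φ ξ, ∃ p ∈ S, (∀ k, (1 - η) * p.1 k ≤ x.1 k) ∧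
    ∀ i, |x.2 i - p.2 i| ≤ η

/-- Pass from `x` to a net point `p`, to the fibre of `ζ` over `p.1`, then to the fibre over `x.1`;
the costs are `η`, `η` and `2 * M * η`. -/
theorem IsDualNet.exists_close [Nonempty κ] (hφ : IsNormMax φ) {η M : ℝ} (hη : 0 < η)
    (hη1 : η ≤ 1) {S : Set ((κ → ℝ) × (I → ℝ))} (hξ : IsDualNet φ ξ η M S)
    (hζ : IsDualNet φ ζ η M S) (v : FormalSum I E) :
    ∃ x ∈ dualSet φ ξ, ∃ t, (x.1, t) ∈ dualSet φ ζ ∧ pairing I φ x v = ξ.1 v ∧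
      ∀ i, |x.2 i - t i| ≤ (2 + 2 * M) * η := by
  obtain ⟨x, hx, hxv⟩ := exists_mem_dualSet_pairing_eq hφ ξ v
  obtain ⟨p, hp, hpx, hpx'⟩ := hξ.covers x hx
  obtain ⟨s, hs, hsp⟩ := hζ.near_fibre p hp
  obtain ⟨t, ht, hts⟩ := exists_mem_dualSet_near hφ hζ.single_le hs hx.1 hη hη1 hpx
  refine ⟨x, hx, t, ht, hxv, fun i => ?_⟩
  have h1 := abs_le.1 (hpx' i)
  have h2 := abs_le.1 (hsp i)
  have h3 := abs_le.1 (hts i)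
  refine abs_le.2 ⟨?_, ?_⟩ <;> linarith [h1.1, h1.2, h2.1, h2.2, h3.1, h3.2]

theorem IsDualNet.typeDist_le [Nonempty κ] (hφ : IsNormMax φ) {η M : ℝ} (hη : 0 < η)
    (hη1 : η ≤ 1) {S : Set ((κ → ℝ) × (I → ℝ))} (hξ : IsDualNet φ ξ η M S)
    (hζ : IsDualNet φ ζ η M S) : typeDist ξ ζ ≤ ENNReal.ofReal ((2 + 2 * M) * η) := by
  refine typeDist_le_of_closeFunctionals (fun v => ?_) fun v => ?_
  · obtain ⟨x, hx, t, ht, hv, hxt⟩ := hξ.exists_close hφ hη hη1 hζ v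
    refine ⟨(pairing I φ x, pairing I φ (x.1, t)), ⟨hx.2, ht.2, fun b => ?_, fun i => ?_⟩, hv⟩
    · simp [pairing_apply]
    · simpa only [pairing_single] using hxt i
  · obtain ⟨x, hx, t, ht, hv, hxt⟩ := hζ.exists_close hφ hη hη1 hξ v
    refine ⟨(pairing I φ (x.1, t), pairing I φ x), ⟨ht.2, hx.2, fun b => ?_, fun i => ?_⟩, hv⟩
    · simp [pairing_apply]
    · simpa only [pairing_single, abs_sub_comm] using hxt i

theorem exists_isDualNet [Nonempty κ] (hφ : IsNormMax φ) {C : Set (κ → ℝ)}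
    (hCs : C ⊆ stdSimplex ℝ κ) (hC : ∀ c ∈ stdSimplex ℝ κ, ∀ η : ℝ, 0 < η →
      ∃ d ∈ C, (∀ k, (1 - η) * d k ≤ c k) ∧ ∀ k, (1 - η) * c k ≤ d k)
    (ξ : TypeSpace I E) {M : ℝ} (hM0 : 0 ≤ M) (hM : ∀ i, ξ.1 (0, Finsupp.single i 1) ≤ M)
    {η : ℝ} (hη : 0 < η) (hη1 : η ≤ 1) :
    ∃ S : Finset ((κ → ℝ) × (I → ℝ)), IsDualNet φ ξ η M S ∧
      (S : Set ((κ → ℝ) × (I → ℝ))) ⊆ C ×ˢ Set.range fun (q : I → ℚ) i => (q i : ℝ) := by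
  classical
  -- Strict inequality is asked only where `p.1 k > 0`: this keeps `U p` open without excluding
  -- points with zero coordinates.
  let U : (κ → ℝ) × (I → ℝ) → Set ((κ → ℝ) × (I → ℝ)) := fun p =>
    {y | (∀ k, 0 < p.1 k → (1 - η) * p.1 k < y.1 k) ∧ ∀ i, |y.2 i - p.2 i| < η}
  have hU : ∀ p, IsOpen (U p) := by
    intro p
    have : U p = (⋂ k, {y | 0 < p.1 k → (1 - η) * p.1 k < y.1 k}) ∩
        ⋂ i, {y | |y.2 i - p.2 i| < η} := by
      ext; simp [U]
    rw [this]
    refine (isOpen_iInter_of_finite fun k => ?_).inter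
      (isOpen_iInter_of_finite fun i => isOpen_lt (by fun_prop) (by fun_prop))
    by_cases hk : 0 < p.1 k
    · simp only [hk, true_imp_iff]
      exact isOpen_lt (by fun_prop) (by fun_prop)
    · simp [hk]
  have hp : ∀ x ∈ dualSet φ ξ, ∃ p ∈ C ×ˢ Set.range fun (q : I → ℚ) i => (q i : ℝ),
      x ∈ U p ∧ ∃ s, (p.1, s) ∈ dualSet φ ξ ∧ ∀ i, |s i - p.2 i| ≤ η := by
    intro x hx
    have hden : 0 < 4 * M + 4 := by linarith
    -- With this tolerance the fibre moves by at most `η / 2`, leaving `η / 2` for rational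
    -- approximation.
    obtain ⟨d, hdC, hd1, hd2⟩ := hC x.1 hx.1 (η / (4 * M + 4)) (by positivity)
    have hlt : η / (4 * M + 4) < η := div_lt_self hη (by linarith)
    obtain ⟨s, hs, hsx⟩ := exists_mem_dualSet_near hφ hM (c := x.1) (s := x.2) hx (hCs hdC)
      (by positivity) (by linarith) hd2
    have hsmall : 2 * M * (η / (4 * M + 4)) ≤ η / 2 := by
      rw [mul_div_assoc', div_le_iff₀ hden]
      nlinarith
    have hq : ∀ i, ∃ q : ℚ, |x.2 i - q| < η / 2 := fun i =>
      Rat.denseRange_cast.exists_dist_lt (x.2 i) (half_pos hη)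
    choose q hq using hq
    refine ⟨(d, fun i => (q i : ℝ)), ⟨hdC, q, rfl⟩, ⟨fun k hk => ?_, fun i => ?_⟩, s, hs,
      fun i => ?_⟩
    · refine lt_of_lt_of_le ?_ (hd1 k)
      exact mul_lt_mul_of_pos_right (by linarith) hk
    · exact (hq i).trans (half_lt_self hη)
    · have h1 := abs_le.1 (hsx i)
      have h2 := abs_lt.1 (hq i)
      refine abs_le.2 ⟨?_, ?_⟩ <;> simp only <;> linarith [h1.1, h1.2, h2.1, h2.2]
  choose! p hpC hxp hpf using hp
  obtain ⟨T, hTK, hT⟩ := (isCompact_dualSet (φ := φ) (ξ := ξ)).elim_nhds_subcover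
    (fun x => U (p x)) fun x hx => (hU _).mem_nhds (hxp x hx)
  refine ⟨T.image p, ⟨hM, fun y hy => ?_, fun x hx => ?_⟩, fun y hy => ?_⟩
  · obtain ⟨x, hx, rfl⟩ := Finset.mem_image.1 (Finset.mem_coe.1 hy)
    exact hpf x (hTK x hx)
  · obtain ⟨y, hyT, hxy⟩ := Set.mem_iUnion₂.1 (hT hx)
    refine ⟨p y, Finset.mem_coe.2 (Finset.mem_image_of_mem p hyT), fun k => ?_,
      fun i => (hxy.2 i).le⟩
    rcases ((hCs (hpC y (hTK y hyT)).1).1 k).eq_or_lt with h0 | h0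
    · rw [← h0, mul_zero]
      exact hx.1.1 k
    · exact (hxy.1 k h0).le
  · obtain ⟨x, hx, rfl⟩ := Finset.mem_image.1 (Finset.mem_coe.1 hy)
    exact hpC x (hTK x hx)

theorem isMetricallySeparable_of_isNormMax [Nonempty κ] (hφ : IsNormMax φ) :
    IsMetricallySeparable I E := by
  obtain ⟨C, hCs, hCc, hC⟩ := exists_countable_comparable_in_stdSimplex κ
  let Q : Set ((κ → ℝ) × (I → ℝ)) := C ×ˢ Set.range fun (q : I → ℚ) i => (q i : ℝ)
  have hQ : Q.Countable := hCc.prod (Set.countable_range _)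
  -- Triples (precision, bound, net) that occur for some type; one type chosen for each gives the
  -- countable dense set.
  let X : Set (ℕ × ℕ × Set ((κ → ℝ) × (I → ℝ))) :=
    {x | (x.2.2.Finite ∧ x.2.2 ⊆ Q) ∧
      ∃ ξ : TypeSpace I E, IsDualNet φ ξ (1 / (x.1 + 1)) x.2.1 x.2.2}
  have hX : X.Countable := by
    refine Set.Countable.mono (s₂ := Set.univ ×ˢ Set.univ ×ˢ {S | S.Finite ∧ S ⊆ Q})
      (fun x hx => ⟨Set.mem_univ _, Set.mem_univ _, hx.1⟩) ?_
    exact Set.countable_univ.prod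
      (Set.countable_univ.prod (Set.countable_ofPred_finite_subset hQ))
  have hrep : ∀ x : X, ∃ ξ : TypeSpace I E,
      IsDualNet φ ξ (1 / (x.1.1 + 1)) x.1.2.1 x.1.2.2 := fun x => x.2.2
  choose rep hrep using hrep
  have := hX.to_subtype
  refine ⟨Set.range rep, Set.countable_range rep, fun ξ ε hε => ?_⟩
  obtain ⟨M, hM⟩ := exists_nat_ge (∑ i, ξ.1 (0, Finsupp.single i 1))
  have hM' : ∀ i, ξ.1 (0, Finsupp.single i 1) ≤ M := fun i =>
    (Finset.single_le_sum (f := fun i => ξ.1 (0, Finsupp.single i 1))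
      (fun i _ => apply_nonneg _ _) (Finset.mem_univ i)).trans hM
  obtain ⟨r, hr, hrε⟩ : ∃ r : ℝ, 0 < r ∧ ENNReal.ofReal r < ε := by
    obtain ⟨r, -, hr, hrε⟩ := ENNReal.lt_iff_exists_real_btwn.1 hε
    exact ⟨r, ENNReal.ofReal_pos.1 hr, hrε⟩
  have hden : (0 : ℝ) < 2 + 2 * M := by positivity
  obtain ⟨m, hm⟩ := exists_nat_one_div_lt (div_pos hr hden)
  have hη : (0 : ℝ) < 1 / (m + 1) := by positivity
  have hη1 : (1 : ℝ) / (m + 1) ≤ 1 := by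
    rw [div_le_one (by positivity)]
    linarith [(m.cast_nonneg : (0 : ℝ) ≤ m)]
  obtain ⟨S, hS, hSQ⟩ := exists_isDualNet hφ hCs hC ξ M.cast_nonneg hM' hη hη1
  let x : X := ⟨(m, M, S), ⟨S.finite_toSet, hSQ⟩, ξ, hS⟩
  refine ⟨rep x, ⟨x, rfl⟩, (hS.typeDist_le hφ hη hη1 (hrep x)).trans_lt
    (lt_of_le_of_lt (ENNReal.ofReal_le_ofReal ?_) hrε)⟩
  rw [lt_div_iff₀ hden] at hm
  linarith

end Pairing

end TypeSpace

theorem mainTheorem11 (E : Type u) [NormedAddCommGroup E] [NormedSpace ℝ E] [CompleteSpace E]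
    [TopologicalSpace.SeparableSpace E] :
    ((FiniteDimensional ℝ E ∧ HasPolyhedralUnitBall E) →
      ∀ n : ℕ, TypeSpace.IsMetricallySeparable (Fin n) E) ∧
    (¬ (FiniteDimensional ℝ E ∧ HasPolyhedralUnitBall E) →
      ∀ n : ℕ, 1 ≤ n → TypeSpace.metricDensityCharacter (Fin n) E = 𝔠) := by
  refine ⟨fun h n => ?_, fun h n hn => TypeSpace.metricDensityCharacter_eq_continuum h hn⟩
  obtain ⟨κ, _, _, φ, hφ⟩ := h.2.exists_isNormMax
  exact TypeSpace.isMetricallySeparable_of_isNormMax hφ
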